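/- Let $c>0$, $c_2>0$ and $0<T<T^*$. For $t>0$ put $$f_t(x)=\mathbf 1_{\{x>0\}}\frac{ct}{\sqrt{2\pi}\,x^{3/2}}\exp\Big(-\frac{c^2t^2}{2x}\Big).$$ A stable-1/2 subordinator with activity parameter $c$ is an increasing Lévy process $\{S_t\}_{t\ge 0}$ such that $S_t$ has density $f_t$ for every $t>0$. Let $p$ be a probability density on $(0,\infty)$, and let $\{S(t,T^*)\}_{0\le t\le T^*}$ be a stable-1/2 random bridge with activity parameter $c$ and terminal density $p$; that is, $S(T^*,T^*)$ has density $p$, and for some stable-1/2 subordinator $\{S_t\}$ with activity parameter $c$ $$\mathbb Q[S(t_1,T^*)\le x_1,\dots,S(t_n,T^*)\le x_n\mid S(T^*,T^*)=z]=\mathbb Q[S_{t_1}\le x_1,\dots,S_{t_n}\le x_n\mid S_{T^*}=z]$$ for all $n\ge1$, all $0<t_1<\dots<t_n<T^*$, all $(x_1,\dots,x_n)\in\mathbb R^n$ and $p(z)\,\mathrm dz$-almost every $z$. Put $\lambda=T^*/T-1$ and $k=c_2/(c\lambda)$, and define the two paid-claims processes, for $0\le t\le T$, by $$\xi^{(1)}_{tT}=S(t,T^*),\qquad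 \xi^{(2)}_{tT}=k^2S(\lambda t+T,T^*)-k^2S(T,T^*).$$ Assume that $m_2=\mathbb E[S(T^*,T^*)^2]<\infty$, and write $m_1=\mathbb E[S(T^*,T^*)]$ and $$C_{T^*}=c\sqrt{2\pi}\int_0^\infty z^{3/2}\,e^{c^2T^{*2}/(2z)}\,\Phi\big(-cT^*z^{-1/2}\big)\,p(z)\,\mathrm dz,$$ where $\Phi$ is the standard normal distribution function. Then the integral $C_{T^*}$ converges, $\xi^{(1)}_{TT}$ and $\xi^{(2)}_{TT}$ have finite second moments and strictly positive variances, and $$\mathbb E[\xi^{(1)}_{TT}]=\tfrac{T}{T^*}m_1,\qquad \mathbb E[\xi^{(2)}_{TT}]=k^2\big(1-\tfrac{T}{T^*}\big)m_1,$$ $$\mathbb E\big[(\xi^{(1)}_{TT})^2\big]=\tfrac{T}{T^*}m_2-\tfrac{T}{T^*}(T^*-T)\,C_{T^*},$$ $$\mathbb E\big[(\xi^{(2)}_{TT})^2\big]=k^4\big(1-\tfrac{T}{T^*}\big)m_2-k^4\big(1-\tfrac{T}{T^*}\big)T\,C_{T^*},$$ $$\mathbb E\big[\xi^{(1)}_{TT}\xi^{(2)}_{TT}\big]=k^2\,\tfrac{T}{T^*}(T^*-T)\,C_{T^*}.$$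 Consequently the correlation of $\xi^{(1)}_{TT}$ and $\xi^{(2)}_{TT}$ is well defined and equals $$\frac{k^2\frac{T}{T^*}(T^*-T)C_{T^*}-k^2\frac{T}{T^*}\big(1-\frac{T}{T^*}\big)m_1^2}{\sqrt{\Big(\frac{T}{T^*}m_2-\frac{T}{T^*}(T^*-T)C_{T^*}-\big(\frac{T}{T^*}m_1\big)^2\Big)\Big(k^4\big(1-\frac{T}{T^*}\big)m_2-k^4\big(1-\frac{T}{T^*}\big)TC_{T^*}-k^4\big(1-\frac{T}{T^*}\big)^2m_1^2\Big)}}.$$ -/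

import Mathlib

open MeasureTheory ProbabilityTheory Set
open scoped NNReal ENNReal

noncomputable section

/-- The density of the stable-1/2 subordinator with activity parameter `c` at time `t`:
`f_t(x) = 1_{x > 0} * c t / (√(2π) x^{3/2}) * exp (-c² t² / (2x))`. -/
def stableHalfDensity (c t x : ℝ) : ℝ :=
  if 0 < x then
    c * t / (Real.sqrt (2 * Real.pi) * x ^ (3 / 2 : ℝ)) * Real.exp (-(c ^ 2 * t ^ 2) / (2 * x))
  else 0

/-- `S` is a stable-1/2 subordinator with activity parameter `c` under `P`: it starts from `0`, has
independent and stationary increments, the increment over `[s, t]` has density `f_{t-s}`, and almost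
every path is increasing and right-continuous (so it also has left limits). -/
structure IsStableHalfSubordinator {Ω : Type*} [MeasurableSpace Ω] (c : ℝ)
    (S : ℝ≥0 → Ω → ℝ) (P : Measure Ω) : Prop where
  measurable : ∀ t, Measurable (S t)
  zero : ∀ᵐ ω ∂P, S 0 ω = 0
  indep : HasIndepIncrements S P
  law : ∀ s t : ℝ≥0, s < t →
    P.map (fun ω => S t ω - S s ω)
      = (volume : Measure ℝ).withDensity
          (fun x => ENNReal.ofReal (stableHalfDensity c ((t : ℝ) - s) x))
  monotone : ∀ᵐ ω ∂P, Monotone (fun t => S t ω)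
  rightContinuous : ∀ᵐ ω ∂P, ∀ t, ContinuousWithinAt (fun u => S u ω) (Ici t) t

/-- The measure `ν(dz) = 1_{z > 0} p(z) dz` on the real line. -/
def priorLaw (p : ℝ → ℝ) : Measure ℝ :=
  (volume.restrict (Ioi (0 : ℝ))).withDensity (fun z => ENNReal.ofReal (p z))

/-- `ξ` (looked at on `[0, T]`) is a stable-1/2 random bridge with activity parameter `c` whose
terminal value has density `p` on `(0, ∞)`: for some stable-1/2 subordinator `S` with activity
parameter `c`, the conditional finite-dimensional laws of `ξ` given `ξ_T = z` and of `S` given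
`S_T = z` agree for almost every `z` under the terminal law. (The latter are determined up to a
Lebesgue-null set of `z > 0`, since `S_T` has a density that is positive on `(0, ∞)`; the terminal
law does not charge such sets.) -/
structure IsStableHalfRandomBridge {Ω : Type*} [MeasurableSpace Ω] (c : ℝ) (T : ℝ≥0) (p : ℝ → ℝ)
    (ξ : ℝ≥0 → Ω → ℝ) (P : Measure Ω) [IsProbabilityMeasure P] : Prop where
  measurable : ∀ t, t ≤ T → Measurable (ξ t)
  law_terminal : P.map (ξ T) = priorLaw p
  bridge : ∃ (Ω' : Type) (_ : MeasurableSpace Ω') (P' : Measure Ω') (_ : IsProbabilityMeasure P')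
    (S : ℝ≥0 → Ω' → ℝ), IsStableHalfSubordinator c S P' ∧
      ∀ (n : ℕ) (t : Fin (n + 1) → ℝ≥0) (x : Fin (n + 1) → ℝ), StrictMono t →
        (∀ i, 0 < t i ∧ t i < T) →
        ∀ᵐ z ∂(priorLaw p),
          condDistrib (fun ω i => ξ (t i) ω) (ξ T) P z (Iic x)
            = condDistrib (fun ω i => S (t i) ω) (S T) P' z (Iic x)

/-- `λ = T*/T - 1`, which is used for `0 < T < T*` only. -/
def timeRatio (T Ts : ℝ≥0) : ℝ≥0 := Ts / T - 1

/-- `k = c₂ / (c λ)`. -/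
def lossScale (c c₂ : ℝ) (T Ts : ℝ≥0) : ℝ := c₂ / (c * (timeRatio T Ts : ℝ))

/-- The first paid-claims process `ξ⁽¹⁾_{tT} = S(t, T*)`, `0 ≤ t ≤ T`. -/
def paidClaims₁ {Ω : Type*} (S : ℝ≥0 → Ω → ℝ) (t : ℝ≥0) (ω : Ω) : ℝ := S t ω

/-- The second paid-claims process `ξ⁽²⁾_{tT} = k² S(λ t + T, T*) - k² S(T, T*)`, `0 ≤ t ≤ T`. -/
def paidClaims₂ {Ω : Type*} (c c₂ : ℝ) (T Ts : ℝ≥0) (S : ℝ≥0 → Ω → ℝ) (t : ℝ≥0) (ω : Ω) : ℝ :=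
  lossScale c c₂ T Ts ^ 2 * S (timeRatio T Ts * t + T) ω - lossScale c c₂ T Ts ^ 2 * S T ω

/-- The standard normal distribution function. -/
def stdNormalCDF (x : ℝ) : ℝ := cdf (gaussianReal 0 1) x

/-- The integrand of `C_{T*}`. -/
def crossIntegrand (c Ts : ℝ) (p : ℝ → ℝ) (z : ℝ) : ℝ :=
  z ^ (3 / 2 : ℝ) * Real.exp (c ^ 2 * Ts ^ 2 / (2 * z))
    * stdNormalCDF (-(c * Ts * z ^ (-(1 / 2) : ℝ))) * p z

/-- `C_{T*} = c √(2π) ∫₀^∞ z^{3/2} exp (c² T*² / (2z)) Φ(-c T* z^{-1/2}) p(z) dz`. -/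
def crossConst (c Ts : ℝ) (p : ℝ → ℝ) : ℝ :=
  c * Real.sqrt (2 * Real.pi) * ∫ z in Ioi (0 : ℝ), crossIntegrand c Ts p z

/-- The correlation of two real random variables, in terms of their first two moments. -/
def correlation {Ω : Type*} [MeasurableSpace Ω] (X Y : Ω → ℝ) (P : Measure Ω) : ℝ :=
  ((∫ ω, X ω * Y ω ∂P) - (∫ ω, X ω ∂P) * (∫ ω, Y ω ∂P)) /
    Real.sqrt (((∫ ω, X ω ^ 2 ∂P) - (∫ ω, X ω ∂P) ^ 2) *
      ((∫ ω, Y ω ^ 2 ∂P) - (∫ ω, Y ω ∂P) ^ 2))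

end

/-! For fixed `x`, let `g` be the centred Gaussian density of variance `x / c²`, read as a function
of time. Then `x f_t(x) = t g(t)` and `-g'(t) = c² f_t(x)`, hence `x f_t(x) = c² t ∫_t^∞ f_s(x) ds`
(`lintegral_mul_stableHalfLaw`). A factor `x` thus becomes an integral over later times, under which
the convolution semigroup can act.

For independent `X ~ f_t` and `Y ~ f_r` this gives `E[X φ(X+Y)] = t/(t+r) E[(X+Y) φ(X+Y)]`. Using it
for `X` and then for `Y` gives `E[XY φ(X+Y)] = c² t r ∫ φ(w) Pr[N(0, w/c²) > t+r] dw`, which is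
where `Φ` in `C` comes from.

The two increments of the bridge have the product of two stable laws as joint law, reweighted by `p
/ f_{T*}` at their sum (`IsStableHalfRandomBridge.lintegral_increments`), so this weight is absorbed
into `φ`. The identities hold in `ℝ≥0∞`; finiteness of `m₂` then yields convergence of `C` and the
real-valued moments. Variances are positive because neither increment has an atom. -/

/-! ### Stable-1/2 densities and size-biasing. -/

/-- The law of the stable-1/2 subordinator with activity parameter `c` at time `t`. -/
noncomputable def stableHalfLaw (c t : ℝ) : Measure ℝ :=
  (volume : Measure ℝ).withDensity (fun x => ENNReal.ofReal (stableHalfDensity c t x))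

lemma measurable_stableHalfDensity_uncurry (c : ℝ) :
    Measurable (fun q : ℝ × ℝ => stableHalfDensity c q.1 q.2) := by
  unfold stableHalfDensity
  exact Measurable.ite (measurableSet_lt measurable_const measurable_snd) (by fun_prop)
    measurable_const

lemma measurable_stableHalfDensity (c t : ℝ) : Measurable (stableHalfDensity c t) :=
  (measurable_stableHalfDensity_uncurry c).comp measurable_prodMk_left

lemma stableHalfDensity_nonneg {c t : ℝ} (hc : 0 < c) (ht : 0 ≤ t) (x : ℝ) :
    0 ≤ stableHalfDensity c t x := by
  unfold stableHalfDensity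
  split_ifs <;> positivity

lemma stableHalfDensity_pos {c t x : ℝ} (hc : 0 < c) (ht : 0 < t) (hx : 0 < x) :
    0 < stableHalfDensity c t x := by
  unfold stableHalfDensity
  rw [if_pos hx]
  positivity

lemma stableHalfDensity_of_nonpos {c t x : ℝ} (hx : x ≤ 0) : stableHalfDensity c t x = 0 :=
  if_neg hx.not_gt

lemma toNNReal_div_sq_ne_zero {c x : ℝ} (hc : 0 < c) (hx : 0 < x) :
    (x / c ^ 2).toNNReal ≠ 0 := by
  simp only [ne_eq, Real.toNNReal_eq_zero, not_le]
  positivity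

lemma rpow_three_halves {x : ℝ} (hx : 0 < x) : x ^ (3 / 2 : ℝ) = x * √x := by
  rw [show (3 / 2 : ℝ) = 1 + 1 / 2 by norm_num, Real.rpow_add hx, Real.rpow_one,
    Real.sqrt_eq_rpow]

/-- Size-biasing the stable-1/2 density gives a Gaussian kernel in the time variable. -/
lemma mul_stableHalfDensity {c x : ℝ} (hc : 0 < c) (hx : 0 < x) (t : ℝ) :
    x * stableHalfDensity c t x = t * gaussianPDFReal 0 (x / c ^ 2).toNNReal t := by
  have hv : ((x / c ^ 2).toNNReal : ℝ) = x / c ^ 2 := Real.coe_toNNReal _ (by positivity)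
  have h1 : √(2 * Real.pi * (x / c ^ 2)) = √(2 * Real.pi) * √x / c := by
    rw [← mul_div_assoc, Real.sqrt_div (by positivity), Real.sqrt_sq hc.le,
      Real.sqrt_mul (by positivity)]
  have h2 : -(t - 0) ^ 2 / (2 * (x / c ^ 2)) = -(c ^ 2 * t ^ 2) / (2 * x) := by
    field_simp
    ring
  rw [stableHalfDensity, if_pos hx, gaussianPDFReal, hv, h1, h2, rpow_three_halves hx]
  have : √x ≠ 0 := (Real.sqrt_pos.2 hx).ne'
  field_simp

/-- Differentiating the Gaussian in time brings down `-c² t / x`, and `(t / x) g(t)` is the stable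
density. -/
lemma hasDerivAt_gaussianPDFReal_div_sq {c x : ℝ} (hc : 0 < c) (hx : 0 < x) (t : ℝ) :
    HasDerivAt (fun s => -gaussianPDFReal 0 (x / c ^ 2).toNNReal s)
      (c ^ 2 * stableHalfDensity c t x) t := by
  have hv : ((x / c ^ 2).toNNReal : ℝ) = x / c ^ 2 := Real.coe_toNNReal _ (by positivity)
  have h : stableHalfDensity c t x = t / x * gaussianPDFReal 0 (x / c ^ 2).toNNReal t := by
    rw [div_mul_eq_mul_div, ← mul_stableHalfDensity hc hx]
    field_simp
  rw [h]
  unfold gaussianPDFReal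
  have h1 : HasDerivAt (fun s : ℝ => -(s - 0) ^ 2 / (2 * ((x / c ^ 2).toNNReal : ℝ)))
      (-(c ^ 2 * t / x)) t := by
    convert! (((((hasDerivAt_id t).sub_const 0).pow 2).neg).div_const
      (2 * ((x / c ^ 2).toNNReal : ℝ))) using 1
    rw [hv]
    simp
    field_simp
  convert! (h1.exp.const_mul (√(2 * Real.pi * (x / c ^ 2).toNNReal))⁻¹).neg using 1
  ring

lemma tendsto_gaussianPDFReal_atTop (v : ℝ≥0) (hv : v ≠ 0) :
    Filter.Tendsto (gaussianPDFReal 0 v) Filter.atTop (nhds 0) := by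
  unfold gaussianPDFReal
  simp only [sub_zero, neg_div]
  rw [← mul_zero (√(2 * Real.pi * v))⁻¹]
  refine Filter.Tendsto.const_mul _ (Real.tendsto_exp_atBot.comp ?_)
  have hv' : (0 : ℝ) < 2 * v := by positivity
  exact Filter.tendsto_neg_atTop_atBot.comp
    ((Filter.tendsto_pow_atTop two_ne_zero).atTop_div_const hv')

lemma lintegral_Ioi_stableHalfDensity {c x t : ℝ} (hc : 0 < c) (ht : 0 ≤ t) (hx : 0 < x) :
    ENNReal.ofReal (c ^ 2) * ∫⁻ s in Ioi t, ENNReal.ofReal (stableHalfDensity c s x)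
      = ENNReal.ofReal (gaussianPDFReal 0 (x / c ^ 2).toNNReal t) := by
  have hlim : Filter.Tendsto (fun s => -gaussianPDFReal 0 (x / c ^ 2).toNNReal s) Filter.atTop
      (nhds 0) := by
    simpa using (tendsto_gaussianPDFReal_atTop _ (toNNReal_div_sq_ne_zero hc hx)).neg
  have hpos : ∀ s ∈ Ioi t, 0 ≤ c ^ 2 * stableHalfDensity c s x := fun s hs =>
    mul_nonneg (by positivity) (stableHalfDensity_nonneg hc (ht.trans (le_of_lt hs)) x)
  have hd := fun (s : ℝ) (_ : s ∈ Ici t) => hasDerivAt_gaussianPDFReal_div_sq hc hx s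
  have hint := integrableOn_Ioi_deriv_of_nonneg' hd hpos hlim
  have hval := integral_Ioi_of_hasDerivAt_of_nonneg' hd hpos hlim
  rw [zero_sub, neg_neg] at hval
  rw [← hval, ofReal_integral_eq_lintegral_ofReal hint
    ((ae_restrict_iff' measurableSet_Ioi).2 (.of_forall hpos)),
    ← lintegral_const_mul' _ _ ENNReal.ofReal_ne_top]
  simp_rw [ENNReal.ofReal_mul (sq_nonneg c)]

lemma lintegral_stableHalfLaw (c t : ℝ) {φ : ℝ → ℝ≥0∞} (hφ : Measurable φ) :
    ∫⁻ x, φ x ∂stableHalfLaw c t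
      = ∫⁻ x, ENNReal.ofReal (stableHalfDensity c t x) * φ x := by
  rw [stableHalfLaw, lintegral_withDensity_eq_lintegral_mul _
    (measurable_stableHalfDensity c t).ennreal_ofReal hφ]
  rfl

lemma lintegral_stableHalfLaw_eq_setLIntegral (c t : ℝ) {φ : ℝ → ℝ≥0∞} (hφ : Measurable φ) :
    ∫⁻ x, φ x ∂stableHalfLaw c t
      = ∫⁻ x in Ioi 0, ENNReal.ofReal (stableHalfDensity c t x) * φ x := by
  rw [lintegral_stableHalfLaw c t hφ, ← lintegral_indicator measurableSet_Ioi]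
  refine lintegral_congr fun x => ?_
  by_cases hx : 0 < x
  · rw [indicator_of_mem (mem_Ioi.2 hx)]
  · rw [indicator_of_notMem (by simpa using hx), stableHalfDensity_of_nonpos (not_lt.1 hx)]
    simp

/-- Size-biasing the stable-1/2 law amounts to integrating it over all later times. -/
lemma lintegral_mul_stableHalfLaw {c t : ℝ} (hc : 0 < c) (ht : 0 < t) {φ : ℝ → ℝ≥0∞}
    (hφ : Measurable φ) :
    ∫⁻ x, ENNReal.ofReal x * φ x ∂stableHalfLaw c t
      = ENNReal.ofReal (c ^ 2 * t) * ∫⁻ s in Ioi t, ∫⁻ x, φ x ∂stableHalfLaw c s := by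
  have hm : Measurable (fun q : ℝ × ℝ =>
      ENNReal.ofReal (stableHalfDensity c q.1 q.2) * φ q.2) :=
    (measurable_stableHalfDensity_uncurry c).ennreal_ofReal.mul (hφ.comp measurable_snd)
  rw [lintegral_stableHalfLaw_eq_setLIntegral c t (by fun_prop)]
  simp_rw [lintegral_stableHalfLaw_eq_setLIntegral c _ hφ]
  rw [lintegral_lintegral_swap hm.aemeasurable, ← lintegral_const_mul' _ _ ENNReal.ofReal_ne_top]
  refine setLIntegral_congr_fun measurableSet_Ioi fun x hx => ?_
  have hx : 0 < x := hx
  rw [lintegral_mul_const _ (by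
    exact ((measurable_stableHalfDensity_uncurry c).comp measurable_prodMk_right).ennreal_ofReal),
    ← mul_assoc, ← mul_assoc, mul_comm (c ^ 2), ENNReal.ofReal_mul ht.le,
    mul_assoc (ENNReal.ofReal t),
    lintegral_Ioi_stableHalfDensity hc ht.le hx, ← ENNReal.ofReal_mul ht.le,
    ← mul_stableHalfDensity hc hx, mul_comm x,
    ENNReal.ofReal_mul (stableHalfDensity_nonneg hc ht.le x)]

lemma setLIntegral_Ioi_add_right (g : ℝ → ℝ≥0∞) (t r : ℝ) :
    ∫⁻ s in Ioi t, g (s + r) = ∫⁻ s in Ioi (t + r), g s := by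
  rw [← lintegral_indicator measurableSet_Ioi, ← lintegral_indicator measurableSet_Ioi,
    ← lintegral_add_right_eq_self ((Ioi (t + r)).indicator g) r]
  refine lintegral_congr fun s => ?_
  simp [indicator]

/-! ### Mixed moments of two independent stable-1/2 variables. -/

instance (c t : ℝ) : SFinite (stableHalfLaw c t) := by
  unfold stableHalfLaw; infer_instance

/-- The stable-1/2 laws with activity parameter `c` form a convolution semigroup. -/
def IsStableHalfSemigroup (c : ℝ) : Prop :=
  ∀ s r : ℝ, 0 < s → 0 < r → ∀ φ : ℝ → ℝ≥0∞, Measurable φ →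
    ∫⁻ x, ∫⁻ y, φ (x + y) ∂stableHalfLaw c r ∂stableHalfLaw c s
      = ∫⁻ w, φ w ∂stableHalfLaw c (s + r)

/-- Size-biasing at time `t` gives an integral over `s > t` of laws at time `s + r`, which is the
size-biasing at time `t + r`. Only the prefactors `c² t` and `c² (t + r)` differ. -/
lemma IsStableHalfSemigroup.lintegral_fst {c t r : ℝ} (h : IsStableHalfSemigroup c) (hc : 0 < c)
    (ht : 0 < t) (hr : 0 < r) {φ : ℝ → ℝ≥0∞} (hφ : Measurable φ) :
    ∫⁻ x, ∫⁻ y, ENNReal.ofReal x * φ (x + y) ∂stableHalfLaw c r ∂stableHalfLaw c t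
      = ENNReal.ofReal (t / (t + r))
        * ∫⁻ w, ENNReal.ofReal w * φ w ∂stableHalfLaw c (t + r) := by
  have hin : ∀ x : ℝ, ∫⁻ y, ENNReal.ofReal x * φ (x + y) ∂stableHalfLaw c r
      = ENNReal.ofReal x * ∫⁻ y, φ (x + y) ∂stableHalfLaw c r := fun x =>
    lintegral_const_mul' _ _ ENNReal.ofReal_ne_top
  have hm : Measurable fun x : ℝ => ∫⁻ y, φ (x + y) ∂stableHalfLaw c r :=
    Measurable.lintegral_prod_right' (f := fun q : ℝ × ℝ => φ (q.1 + q.2)) (by fun_prop)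
  simp_rw [hin]
  rw [lintegral_mul_stableHalfLaw hc ht hm, lintegral_mul_stableHalfLaw hc (by positivity) hφ,
    ← setLIntegral_Ioi_add_right, ← mul_assoc, ← ENNReal.ofReal_mul (by positivity)]
  congr 1
  · congr 1
    field_simp
  · exact setLIntegral_congr_fun measurableSet_Ioi fun s hs => h s r (ht.trans hs) hr φ hφ

lemma IsStableHalfSemigroup.lintegral_snd {c t r : ℝ} (h : IsStableHalfSemigroup c) (hc : 0 < c)
    (ht : 0 < t) (hr : 0 < r) {φ : ℝ → ℝ≥0∞} (hφ : Measurable φ) :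
    ∫⁻ x, ∫⁻ y, ENNReal.ofReal y * φ (x + y) ∂stableHalfLaw c r ∂stableHalfLaw c t
      = ENNReal.ofReal (r / (t + r))
        * ∫⁻ w, ENNReal.ofReal w * φ w ∂stableHalfLaw c (t + r) := by
  rw [lintegral_lintegral_swap (Measurable.aemeasurable (by fun_prop)), add_comm t r,
    ← h.lintegral_fst hc hr ht hφ]
  simp_rw [add_comm]

/-- Size-bias the first variable, then apply `lintegral_snd` at each later time. What is left is a
time integral of a Gaussian density from `t + r` on, that is, a tail probability. -/
lemma IsStableHalfSemigroup.lintegral_fst_mul_snd {c t r : ℝ} (h : IsStableHalfSemigroup c)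
    (hc : 0 < c) (ht : 0 < t) (hr : 0 < r) {φ : ℝ → ℝ≥0∞} (hφ : Measurable φ) :
    ∫⁻ x, ∫⁻ y, ENNReal.ofReal x * (ENNReal.ofReal y * φ (x + y))
        ∂stableHalfLaw c r ∂stableHalfLaw c t
      = ENNReal.ofReal (c ^ 2 * t * r)
        * ∫⁻ w in Ioi 0, φ w * gaussianReal 0 (w / c ^ 2).toNNReal (Ioi (t + r)) := by
  have hin : ∀ x : ℝ, ∫⁻ y, ENNReal.ofReal x * (ENNReal.ofReal y * φ (x + y)) ∂stableHalfLaw c r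
      = ENNReal.ofReal x * ∫⁻ y, ENNReal.ofReal y * φ (x + y) ∂stableHalfLaw c r := fun x =>
    lintegral_const_mul' _ _ ENNReal.ofReal_ne_top
  have hm : Measurable fun x : ℝ => ∫⁻ y, ENNReal.ofReal y * φ (x + y) ∂stableHalfLaw c r :=
    Measurable.lintegral_prod_right' (f := fun q : ℝ × ℝ => ENNReal.ofReal q.2 * φ (q.1 + q.2))
      (by fun_prop)
  -- The `1 / v` from `lintegral_snd` cancels the `v` in `w f_v(w) = v g(v)`, leaving a pure
  -- Gaussian density in `v`.
  have hpt : ∀ v, 0 < v → ENNReal.ofReal (r / v) * ∫⁻ w, ENNReal.ofReal w * φ w ∂stableHalfLaw c v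
      = ENNReal.ofReal r * ∫⁻ w in Ioi 0,
          φ w * ENNReal.ofReal (gaussianPDFReal 0 (w / c ^ 2).toNNReal v) := by
    intro v hv
    rw [lintegral_stableHalfLaw_eq_setLIntegral c v (by fun_prop),
      ← lintegral_const_mul' _ _ ENNReal.ofReal_ne_top,
      ← lintegral_const_mul' _ _ ENNReal.ofReal_ne_top]
    refine setLIntegral_congr_fun measurableSet_Ioi fun w hw => ?_
    have hw : 0 < w := hw
    have hE : r / v * (stableHalfDensity c v w * w)
        = r * gaussianPDFReal 0 (w / c ^ 2).toNNReal v := by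
      rw [mul_comm _ w, mul_stableHalfDensity hc hw]
      field_simp
    rw [← mul_assoc (ENNReal.ofReal (stableHalfDensity c v w)),
      ← ENNReal.ofReal_mul (stableHalfDensity_nonneg hc hv.le w), ← mul_assoc,
      ← ENNReal.ofReal_mul (by positivity), hE, ENNReal.ofReal_mul hr.le, mul_assoc,
      mul_comm (φ w)]
  simp_rw [hin]
  rw [lintegral_mul_stableHalfLaw hc ht hm,
    setLIntegral_congr_fun measurableSet_Ioi fun s (hs : t < s) =>
      h.lintegral_snd hc (ht.trans hs) hr hφ,
    setLIntegral_Ioi_add_right (fun v => ENNReal.ofReal (r / v)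
      * ∫⁻ w, ENNReal.ofReal w * φ w ∂stableHalfLaw c v),
    setLIntegral_congr_fun measurableSet_Ioi fun v (hv : t + r < v) => hpt v (by linarith),
    lintegral_const_mul' _ _ ENNReal.ofReal_ne_top, ← mul_assoc,
    ← ENNReal.ofReal_mul (by positivity)]
  congr 1
  rw [lintegral_lintegral_swap (Measurable.aemeasurable
    ((hφ.comp measurable_snd).mul (by fun_prop)))]
  refine setLIntegral_congr_fun measurableSet_Ioi fun w hw => ?_
  rw [lintegral_const_mul _ (by fun_prop), gaussianReal_apply _ (toNNReal_div_sq_ne_zero hc hw)]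
  rfl

lemma gaussianReal_Ioi_eq_stdNormalCDF {c w : ℝ} (hc : 0 < c) (hw : 0 < w) (t : ℝ) :
    gaussianReal 0 (w / c ^ 2).toNNReal (Ioi t)
      = ENNReal.ofReal (stdNormalCDF (-(c * t * w ^ (-(1 / 2) : ℝ)))) := by
  have hs : 0 < √w := Real.sqrt_pos.2 hw
  -- The negative scale turns the upper tail into a lower one, so that it is read off the
  -- distribution function.
  have hmap : gaussianReal 0 (w / c ^ 2).toNNReal
      = (gaussianReal 0 1).map (fun x => -(√w / c) * x) := by
    rw [gaussianReal_map_const_mul]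
    congr 1
    · simp
    · ext
      rw [Real.coe_toNNReal _ (by positivity)]
      simp [div_pow, Real.sq_sqrt hw.le]
  have hpre : (fun x => -(√w / c) * x) ⁻¹' Ioi t = Iio (-(c * t * w ^ (-(1 / 2) : ℝ))) := by
    ext x
    rw [Real.rpow_neg hw.le, ← Real.sqrt_eq_rpow]
    simp only [mem_preimage, mem_Ioi, mem_Iio]
    rw [lt_neg, ← div_eq_mul_inv, div_lt_iff₀ hs, neg_mul, div_mul_eq_mul_div, ← neg_div,
      lt_div_iff₀ hc]
    constructor <;> intro h <;> linarith
  have := nullSingletonClass_gaussianReal (μ := 0) one_ne_zero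
  rw [hmap, Measure.map_apply (by fun_prop) measurableSet_Ioi, hpre, stdNormalCDF, ofReal_cdf,
    measure_congr Iio_ae_eq_Iic]

/-! ### Laws of the subordinator and its increments. -/

section Subordinator

variable {Ω : Type*} [MeasurableSpace Ω] {c : ℝ} {S : ℝ≥0 → Ω → ℝ} {P : Measure Ω}

lemma IsStableHalfSubordinator.map_eq (hS : IsStableHalfSubordinator c S P) {t : ℝ≥0}
    (ht : 0 < t) : P.map (S t) = stableHalfLaw c t := by
  have h := hS.law 0 t ht
  rw [NNReal.coe_zero, sub_zero] at h
  rw [stableHalfLaw, ← h]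
  refine Measure.map_congr ?_
  filter_upwards [hS.zero] with ω hω
  rw [hω, sub_zero]

lemma IsStableHalfSubordinator.map_prodMk_eq [IsProbabilityMeasure P]
    (hS : IsStableHalfSubordinator c S P) {t u : ℝ≥0} (ht : 0 < t) (htu : t < u) :
    P.map (fun ω => (S t ω, S u ω - S t ω))
      = (stableHalfLaw c t).prod (stableHalfLaw c ((u : ℝ) - t)) := by
  have h := hS.indep.indepFun_eval_sub zero_le htu.le hS.zero
  rw [indepFun_iff_map_prod_eq_prod_map_map (hS.measurable t).aemeasurable
    ((hS.measurable u).sub (hS.measurable t)).aemeasurable] at h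
  rw [← hS.map_eq ht, stableHalfLaw, ← hS.law t u htu]
  exact h

lemma IsStableHalfSubordinator.isStableHalfSemigroup [IsProbabilityMeasure P]
    (hS : IsStableHalfSubordinator c S P) : IsStableHalfSemigroup c := by
  intro s r hs hr φ hφ
  lift s to ℝ≥0 using hs.le
  lift r to ℝ≥0 using hr.le
  have hs' : 0 < s := by exact_mod_cast hs
  have hr' : 0 < r := by exact_mod_cast hr
  have h := hS.map_prodMk_eq hs' (lt_add_of_pos_right s hr')
  rw [NNReal.coe_add, add_sub_cancel_left] at h
  have hm := hS.measurable
  rw [← NNReal.coe_add, ← hS.map_eq (add_pos hs' hr'), lintegral_map hφ (hm _),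
    lintegral_lintegral (f := fun x y => φ (x + y)) (Measurable.aemeasurable (by fun_prop)), ← h,
    lintegral_map (by fun_prop) (by fun_prop)]
  simp

end Subordinator

/-! ### From conditional laws to joint laws. -/

lemma preimage_Iic_const_fin_one {α : Type*} (Y : α → ℝ) (x : ℝ) :
    (fun ω (_ : Fin 1) => Y ω) ⁻¹' Iic (fun _ => x) = Y ⁻¹' Iic x := by
  ext ω
  simp [Pi.le_def]

section CondDistrib

variable {Ω Ω' β γ : Type*} [MeasurableSpace Ω] [MeasurableSpace Ω'] [MeasurableSpace β]
  {P : Measure Ω} {P' : Measure Ω'} [IsFiniteMeasure P] [IsFiniteMeasure P']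
  {Z : Ω → β} {Z' : Ω' → β} {ρ : β → ℝ≥0∞}

/-- Both sides disintegrate over the first component; the kernels agree on `s`, and `ρ` converts one
marginal into the other. -/
lemma measure_inter_preimage_eq_of_condDistrib [MeasurableSpace γ] [StandardBorelSpace γ]
    [Nonempty γ] {V : Ω → γ} {V' : Ω' → γ}
    (hZ : Measurable Z) (hV : Measurable V) (hZ' : Measurable Z') (hV' : Measurable V')
    (hρ : Measurable ρ) (hmap : P.map Z = (P'.map Z').withDensity ρ)
    {A : Set β} (hA : MeasurableSet A) {s : Set γ} (hs : MeasurableSet s)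
    (h : ∀ᵐ z ∂(P.map Z), condDistrib V Z P z s = condDistrib V' Z' P' z s) :
    P (Z ⁻¹' A ∩ V ⁻¹' s)
      = P'.withDensity (fun ω => ρ (Z' ω)) (Z' ⁻¹' A ∩ V' ⁻¹' s) := by
  calc P (Z ⁻¹' A ∩ V ⁻¹' s) = P.map (fun ω => (Z ω, V ω)) (A ×ˢ s) := by
        rw [Measure.map_apply (hZ.prodMk hV) (hA.prod hs)]
        rfl
    _ = ∫⁻ q in A ×ˢ s, ρ q.1 ∂(P'.map (fun ω => (Z' ω, V' ω))) := by
        rw [← compProd_map_condDistrib hV.aemeasurable, ← compProd_map_condDistrib hV'.aemeasurable,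
          Measure.compProd_apply_prod hA hs, setLIntegral_congr_fun_ae hA (h.mono fun z hz _ => hz),
          hmap, restrict_withDensity hA,
          lintegral_withDensity_eq_lintegral_mul _ hρ (Kernel.measurable_coe _ hs),
          Measure.setLIntegral_compProd (by fun_prop) hA hs]
        simp
    _ = P'.withDensity (fun ω => ρ (Z' ω)) (Z' ⁻¹' A ∩ V' ⁻¹' s) := by
        rw [setLIntegral_map (hA.prod hs) (by fun_prop) (by fun_prop),
          withDensity_apply _ ((hZ' hA).inter (hV' hs))]
        rfl

/-- If two pairs have the same conditional distribution functions of the second component given the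
first, and the law of one first component has a density with respect to the law of the other, then
the joint laws are related by the same density. -/
lemma map_prodMk_eq_of_condDistrib {X : Ω → ℝ} {X' : Ω' → ℝ}
    (hZ : Measurable Z) (hX : Measurable X) (hZ' : Measurable Z') (hX' : Measurable X')
    (hρ : Measurable ρ) (hmap : P.map Z = (P'.map Z').withDensity ρ)
    (h : ∀ x : Fin 1 → ℝ, ∀ᵐ z ∂(P.map Z), condDistrib (fun ω (_ : Fin 1) => X ω) Z P z (Iic x)
      = condDistrib (fun ω (_ : Fin 1) => X' ω) Z' P' z (Iic x)) :
    P.map (fun ω => (Z ω, X ω))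
      = (P'.withDensity (fun ω => ρ (Z' ω))).map (fun ω => (Z' ω, X' ω)) := by
  refine Measure.ext_prod fun {A s} hA hs => ?_
  have key : (P.restrict (Z ⁻¹' A)).map X
      = ((P'.withDensity (fun ω => ρ (Z' ω))).restrict (Z' ⁻¹' A)).map X' := by
    -- The null set in `h` depends on `x`. Integrating over `A` first, then extending from
    -- half-lines to Borel sets, avoids having to choose a common one.
    refine Measure.ext_of_Iic _ _ fun x => ?_
    have := measure_inter_preimage_eq_of_condDistrib hZ (by fun_prop) hZ' (by fun_prop) hρ hmap hA
      measurableSet_Iic (h fun _ => x)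
    rw [Measure.map_apply hX measurableSet_Iic, Measure.map_apply hX' measurableSet_Iic,
      Measure.restrict_apply (hX measurableSet_Iic), Measure.restrict_apply (hX' measurableSet_Iic),
      inter_comm, inter_comm (X' ⁻¹' _)]
    rwa [preimage_Iic_const_fin_one, preimage_Iic_const_fin_one] at this
  have h2 := congrArg (fun m => m s) key
  simp only [Measure.map_apply hX hs, Measure.map_apply hX' hs, Measure.restrict_apply (hX hs),
    Measure.restrict_apply (hX' hs)] at h2
  rw [Measure.map_apply (by fun_prop) (hA.prod hs), Measure.map_apply (by fun_prop) (hA.prod hs),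
    mk_preimage_prod, mk_preimage_prod, inter_comm, h2, inter_comm]

end CondDistrib

/-! ### The bridge as a change of measure. -/

/-- The density of the terminal law of a stable-1/2 random bridge with respect to the law of the
subordinator at the terminal time. -/
noncomputable def bridgeDensity (c t : ℝ) (p : ℝ → ℝ) (w : ℝ) : ℝ≥0∞ :=
  ENNReal.ofReal (p w / stableHalfDensity c t w)

lemma measurable_bridgeDensity {c t : ℝ} {p : ℝ → ℝ} (hp : Measurable p) :
    Measurable (bridgeDensity c t p) :=
  (hp.div (measurable_stableHalfDensity c t)).ennreal_ofReal

/-- Dividing by the stable density is harmless: it is positive on `(0, ∞)`, which carries both laws.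
-/
lemma priorLaw_eq_withDensity {c t : ℝ} (hc : 0 < c) (ht : 0 < t) {p : ℝ → ℝ} (hp : Measurable p) :
    priorLaw p = (stableHalfLaw c t).withDensity (bridgeDensity c t p) := by
  ext A hA
  rw [priorLaw, withDensity_apply _ hA, withDensity_apply _ hA, ← lintegral_indicator hA,
    ← lintegral_indicator hA,
    lintegral_stableHalfLaw_eq_setLIntegral c t ((measurable_bridgeDensity hp).indicator hA)]
  refine setLIntegral_congr_fun measurableSet_Ioi fun w hw => ?_
  have hf := stableHalfDensity_pos hc ht hw
  by_cases hwA : w ∈ A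
  · simp only [indicator_of_mem hwA, bridgeDensity]
    rw [← ENNReal.ofReal_mul hf.le, mul_div_cancel₀ _ hf.ne']
  · simp [indicator_of_notMem hwA]

lemma stableHalfLaw_singleton (c t a : ℝ) : stableHalfLaw c t {a} = 0 :=
  withDensity_absolutelyContinuous _ _ (measure_singleton a)

lemma stableHalfLaw_Iio_zero (c t : ℝ) : stableHalfLaw c t (Iio 0) = 0 := by
  rw [stableHalfLaw, withDensity_apply _ measurableSet_Iio]
  refine setLIntegral_eq_zero measurableSet_Iio fun x hx => ?_
  simp [stableHalfDensity_of_nonpos (le_of_lt hx)]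

section Bridge

variable {Ω : Type*} [MeasurableSpace Ω] {P : Measure Ω} [IsProbabilityMeasure P] {c : ℝ}
  {T Ts : ℝ≥0} {p : ℝ → ℝ} {S : ℝ≥0 → Ω → ℝ}

lemma IsStableHalfRandomBridge.isStableHalfSemigroup (hS : IsStableHalfRandomBridge c Ts p S P) :
    IsStableHalfSemigroup c := by
  obtain ⟨Ω', _, P', _, S', hS', -⟩ := hS.bridge
  exact hS'.isStableHalfSemigroup

/-- The joint law of the two increments of a stable-1/2 random bridge over `[0, T]` and `[T, Ts]`. -/
lemma IsStableHalfRandomBridge.lintegral_increments (hS : IsStableHalfRandomBridge c Ts p S P)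
    (hc : 0 < c) (hT : 0 < T) (hTs : T < Ts) (hp : Measurable p) {F : ℝ → ℝ → ℝ≥0∞}
    (hF : Measurable (Function.uncurry F)) :
    ∫⁻ ω, F (S T ω) (S Ts ω - S T ω) ∂P
      = ∫⁻ x, ∫⁻ y, bridgeDensity c Ts p (x + y) * F x y ∂stableHalfLaw c ((Ts : ℝ) - T)
          ∂stableHalfLaw c T := by
  obtain ⟨Ω', _, P', _, S', hS', hb⟩ := hS.bridge
  have hρ := measurable_bridgeDensity (c := c) (t := Ts) hp
  have hTs0 : 0 < Ts := hT.trans hTs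
  have hX := hS.measurable T hTs.le
  have hZ := hS.measurable Ts le_rfl
  have hX' := hS'.measurable T
  have hZ' := hS'.measurable Ts
  have hlaw := map_prodMk_eq_of_condDistrib hZ hX hZ' hX' hρ
    (by rw [hS.law_terminal, hS'.map_eq hTs0,
      priorLaw_eq_withDensity hc (NNReal.coe_pos.2 hTs0) hp])
    fun x => by
      rw [hS.law_terminal]
      -- `n = 0` means a single time: the conditional law of `S T` given the terminal value
      -- suffices.
      exact hb 0 (fun _ => T) x (fun i j hij => by omega) fun _ => ⟨hT, hTs⟩
  have hF1 : Measurable fun q : ℝ × ℝ => F q.2 (q.1 - q.2) :=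
    hF.comp (measurable_snd.prodMk (measurable_fst.sub measurable_snd))
  have hF2 : Measurable fun q : ℝ × ℝ => bridgeDensity c Ts p (q.1 + q.2) * F q.1 q.2 :=
    (hρ.comp (measurable_fst.add measurable_snd)).mul hF
  calc ∫⁻ ω, F (S T ω) (S Ts ω - S T ω) ∂P
      = ∫⁻ q, F q.2 (q.1 - q.2) ∂(P.map (fun ω => (S Ts ω, S T ω))) := by
        rw [lintegral_map hF1 (hZ.prodMk hX)]
    _ = ∫⁻ ω, bridgeDensity c Ts p (S' Ts ω) * F (S' T ω) (S' Ts ω - S' T ω) ∂P' := by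
        rw [hlaw, lintegral_map hF1 (hZ'.prodMk hX')]
        exact lintegral_withDensity_eq_lintegral_mul _ (hρ.comp hZ') (hF1.comp (hZ'.prodMk hX'))
    _ = ∫⁻ q, bridgeDensity c Ts p (q.1 + q.2) * F q.1 q.2
          ∂(P'.map (fun ω => (S' T ω, S' Ts ω - S' T ω))) := by
        rw [lintegral_map hF2 (by fun_prop)]
        simp
    _ = _ := by
        rw [hS'.map_prodMk_eq hT hTs, lintegral_prod _ hF2.aemeasurable]

lemma IsStableHalfRandomBridge.lintegral_terminal (hS : IsStableHalfRandomBridge c Ts p S P)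
    (hc : 0 < c) (hT : 0 < T) (hTs : T < Ts) (hp : Measurable p) {φ : ℝ → ℝ≥0∞}
    (hφ : Measurable φ) :
    ∫⁻ ω, φ (S Ts ω) ∂P = ∫⁻ w, bridgeDensity c Ts p w * φ w ∂stableHalfLaw c Ts := by
  have hr : (0 : ℝ) < Ts - T := sub_pos.2 (NNReal.coe_lt_coe.2 hTs)
  have h := hS.lintegral_increments hc hT hTs hp (F := fun x y => φ (x + y)) (by
    exact hφ.comp (measurable_fst.add measurable_snd))
  have hm := hS.isStableHalfSemigroup T _ (NNReal.coe_pos.2 hT) hr _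
    ((measurable_bridgeDensity (c := c) (t := Ts) hp).mul hφ)
  rw [add_sub_cancel] at hm
  simp only [add_sub_cancel] at h
  rw [h]
  exact hm

/-- Used with `φ = 1` for the mean and with `φ` the identity for the product with the terminal
value. -/
lemma IsStableHalfRandomBridge.lintegral_fst_mul (hS : IsStableHalfRandomBridge c Ts p S P)
    (hc : 0 < c) (hT : 0 < T) (hTs : T < Ts) (hp : Measurable p) {φ : ℝ → ℝ≥0∞}
    (hφ : Measurable φ) :
    ∫⁻ ω, ENNReal.ofReal (S T ω) * φ (S Ts ω) ∂P
      = ENNReal.ofReal (T / Ts) * ∫⁻ ω, ENNReal.ofReal (S Ts ω) * φ (S Ts ω) ∂P := by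
  have hr : (0 : ℝ) < Ts - T := sub_pos.2 (NNReal.coe_lt_coe.2 hTs)
  have hρ := measurable_bridgeDensity (c := c) (t := Ts) hp
  have h := hS.lintegral_increments hc hT hTs hp
    (F := fun x y => ENNReal.ofReal x * φ (x + y)) (by
      exact measurable_fst.ennreal_ofReal.mul (hφ.comp (measurable_fst.add measurable_snd)))
  have hm := hS.isStableHalfSemigroup.lintegral_fst hc (NNReal.coe_pos.2 hT) hr (hρ.mul hφ)
  rw [add_sub_cancel] at hm
  simp only [add_sub_cancel] at h
  rw [h, hS.lintegral_terminal hc hT hTs hp (φ := fun w => ENNReal.ofReal w * φ w) (by fun_prop)]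
  simp only [Pi.mul_apply] at hm
  simp_rw [mul_left_comm (bridgeDensity _ _ _ _) (ENNReal.ofReal _)]
  exact hm

lemma IsStableHalfRandomBridge.lintegral_fst_mul_snd (hS : IsStableHalfRandomBridge c Ts p S P)
    (hc : 0 < c) (hT : 0 < T) (hTs : T < Ts) (hp : Measurable p) :
    ∫⁻ ω, ENNReal.ofReal (S T ω) * ENNReal.ofReal (S Ts ω - S T ω) ∂P
      = ∫⁻ w in Ioi 0, ENNReal.ofReal
          (c * T * (Ts - T) * √(2 * Real.pi) / Ts * crossIntegrand c Ts p w) := by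
  have hT' : (0 : ℝ) < T := NNReal.coe_pos.2 hT
  have hTs' : (0 : ℝ) < Ts := hT'.trans (NNReal.coe_lt_coe.2 hTs)
  have hr : (0 : ℝ) < Ts - T := sub_pos.2 (NNReal.coe_lt_coe.2 hTs)
  have hρ := measurable_bridgeDensity (c := c) (t := Ts) hp
  have h := hS.lintegral_increments hc hT hTs hp
    (F := fun x y => ENNReal.ofReal x * ENNReal.ofReal y) (by
      exact measurable_fst.ennreal_ofReal.mul measurable_snd.ennreal_ofReal)
  -- Here `φ` is the weight `p / f_{T*}` itself; its denominator supplies the `z^{3/2}` and the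
  -- exponential in the integrand of `C`.
  have hm := hS.isStableHalfSemigroup.lintegral_fst_mul_snd hc hT' hr hρ
  rw [add_sub_cancel] at hm
  rw [h]
  simp_rw [mul_comm (bridgeDensity _ _ _ _), mul_assoc (ENNReal.ofReal _)]
  rw [hm, ← lintegral_const_mul' _ _ ENNReal.ofReal_ne_top]
  refine setLIntegral_congr_fun measurableSet_Ioi fun w hw => ?_
  have hw : 0 < w := hw
  have hΦ : 0 ≤ stdNormalCDF (-(c * Ts * w ^ (-(1 / 2) : ℝ))) := cdf_nonneg _ _
  rw [gaussianReal_Ioi_eq_stdNormalCDF hc hw, bridgeDensity, ← ENNReal.ofReal_mul' hΦ,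
    ← ENNReal.ofReal_mul (by positivity)]
  congr 1
  rw [crossIntegrand, stableHalfDensity, if_pos hw, neg_div, Real.exp_neg]
  have := Real.sqrt_ne_zero'.2 Real.two_pi_pos
  field_simp

/-- The reweighted product law charges nothing that a marginal stable law ignores. Negative
half-lines give monotonicity, singletons give absence of atoms. -/
lemma IsStableHalfRandomBridge.ae_notMem (hS : IsStableHalfRandomBridge c Ts p S P)
    (hc : 0 < c) (hT : 0 < T) (hTs : T < Ts) (hp : Measurable p) {N : Set ℝ}
    (hN : MeasurableSet N) (h0 : ∀ t, stableHalfLaw c t N = 0) :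
    (∀ᵐ ω ∂P, S T ω ∉ N) ∧ ∀ᵐ ω ∂P, S Ts ω - S T ω ∉ N := by
  have hX := hS.measurable T hTs.le
  have hZ := hS.measurable Ts le_rfl
  have hm : Measurable (N.indicator (1 : ℝ → ℝ≥0∞)) := measurable_one.indicator hN
  have hae : ∀ t, ∀ᵐ x ∂stableHalfLaw c t, N.indicator (1 : ℝ → ℝ≥0∞) x = 0 := fun t => by
    filter_upwards [measure_eq_zero_iff_ae_notMem.1 (h0 t)] with x hx
    exact indicator_of_notMem hx _
  have hind : ∀ x, N.indicator (1 : ℝ → ℝ≥0∞) x = 0 → x ∉ N := fun x hx hxN => by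
    simp [indicator_of_mem hxN] at hx
  constructor
  · have h := hS.lintegral_increments hc hT hTs hp (F := fun x _ => N.indicator 1 x) (by
      exact hm.comp measurable_fst)
    have hz : ∫⁻ x, ∫⁻ y, bridgeDensity c Ts p (x + y) * N.indicator 1 x
        ∂stableHalfLaw c ((Ts : ℝ) - T) ∂stableHalfLaw c T = 0 := by
      rw [lintegral_congr_ae (g := 0), lintegral_zero_fun]
      filter_upwards [hae T] with x hx
      simp [hx]
    filter_upwards [(lintegral_eq_zero_iff (hm.comp hX)).1 (h.trans hz)]
      with ω hω using hind _ hω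
  · have h := hS.lintegral_increments hc hT hTs hp (F := fun _ y => N.indicator 1 y) (by
      exact hm.comp measurable_snd)
    have hz : ∫⁻ x, ∫⁻ y, bridgeDensity c Ts p (x + y) * N.indicator 1 y
        ∂stableHalfLaw c ((Ts : ℝ) - T) ∂stableHalfLaw c T = 0 := by
      have : ∀ x, ∫⁻ y, bridgeDensity c Ts p (x + y) * N.indicator 1 y
          ∂stableHalfLaw c ((Ts : ℝ) - T) = 0 := fun x => by
        rw [lintegral_congr_ae (g := 0), lintegral_zero_fun]
        filter_upwards [hae (Ts - T)] with y hy
        simp [hy]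
      simp [this]
    filter_upwards [(lintegral_eq_zero_iff (hm.comp (hZ.sub hX))).1 (h.trans hz)]
      with ω hω using hind _ hω

end Bridge

/-! ### Real-valued moments of the bridge. -/

lemma variance_pos_of_forall_ae_ne {Ω : Type*} [MeasurableSpace Ω] {P : Measure Ω}
    [IsProbabilityMeasure P] {X : Ω → ℝ} (hX : MemLp X 2 P) (h : ∀ a, ∀ᵐ ω ∂P, X ω ≠ a) :
    0 < (∫ ω, X ω ^ 2 ∂P) - (∫ ω, X ω ∂P) ^ 2 := by
  have hv : Var[X; P] = (∫ ω, X ω ^ 2 ∂P) - (∫ ω, X ω ∂P) ^ 2 := variance_eq_sub hX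
  rw [← hv]
  refine (variance_nonneg X P).lt_of_ne fun h0 => ?_
  have h1 := ae_eq_integral_of_variance_eq_zero hX h0.symm
  obtain ⟨ω, hω1, hω2⟩ := (h1.and (h (∫ ω, X ω ∂P))).exists
  exact hω2 hω1

lemma measurable_crossIntegrand (c t : ℝ) {p : ℝ → ℝ} (hp : Measurable p) :
    Measurable (crossIntegrand c t p) := by
  have : Measurable stdNormalCDF := (monotone_cdf _).measurable
  unfold crossIntegrand
  fun_prop

lemma crossIntegrand_nonneg (c t : ℝ) {p : ℝ → ℝ} (hp0 : ∀ z, 0 ≤ p z) {z : ℝ} (hz : 0 < z) :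
    0 ≤ crossIntegrand c t p z := by
  have hΦ : 0 ≤ stdNormalCDF (-(c * t * z ^ (-(1 / 2) : ℝ))) := cdf_nonneg _ _
  have := hp0 z
  unfold crossIntegrand
  positivity

/-- A nonnegative function whose lower integral is that of an integrable nonnegative random
variable is integrable, with the same integral. -/
lemma integrable_and_integral_eq_of_lintegral_eq {α β : Type*} [MeasurableSpace α]
    [MeasurableSpace β] {μ : Measure α} {ν : Measure β} {f : α → ℝ} {g : β → ℝ}
    (hf : Integrable f μ) (hf0 : 0 ≤ᵐ[μ] f) (hg : AEStronglyMeasurable g ν) (hg0 : 0 ≤ᵐ[ν] g)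
    (h : ∫⁻ a, ENNReal.ofReal (f a) ∂μ = ∫⁻ b, ENNReal.ofReal (g b) ∂ν) :
    Integrable g ν ∧ ∫ a, f a ∂μ = ∫ b, g b ∂ν := by
  refine ⟨(lintegral_ofReal_ne_top_iff_integrable hg hg0).1 ?_, ?_⟩
  · rw [← h]
    exact (lintegral_ofReal_ne_top_iff_integrable hf.1 hf0).2 hf
  · rw [integral_eq_lintegral_of_nonneg_ae hf0 hf.1, integral_eq_lintegral_of_nonneg_ae hg0 hg, h]

section Bridge

variable {Ω : Type*} [MeasurableSpace Ω] {P : Measure Ω} [IsProbabilityMeasure P] {c : ℝ}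
  {T Ts : ℝ≥0} {p : ℝ → ℝ} {S : ℝ≥0 → Ω → ℝ}

lemma IsStableHalfRandomBridge.ae_nonneg_le (hS : IsStableHalfRandomBridge c Ts p S P)
    (hc : 0 < c) (hT : 0 < T) (hTs : T < Ts) (hp : Measurable p) :
    ∀ᵐ ω ∂P, 0 ≤ S T ω ∧ S T ω ≤ S Ts ω := by
  obtain ⟨h1, h2⟩ := hS.ae_notMem hc hT hTs hp measurableSet_Iio
    (stableHalfLaw_Iio_zero c)
  filter_upwards [h1, h2] with ω hω1 hω2
  simpa using And.intro hω1 hω2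

/-- Almost surely `0 ≤ S T ≤ S Ts`, so the terminal value dominates. -/
lemma IsStableHalfRandomBridge.memLp (hS : IsStableHalfRandomBridge c Ts p S P)
    (hc : 0 < c) (hT : 0 < T) (hTs : T < Ts) (hp : Measurable p)
    (hS2 : Integrable (fun ω => S Ts ω ^ 2) P) : MemLp (S Ts) 2 P ∧ MemLp (S T) 2 P := by
  have hZ : MemLp (S Ts) 2 P :=
    (memLp_two_iff_integrable_sq (hS.measurable Ts le_rfl).aestronglyMeasurable).2 hS2
  refine ⟨hZ, hZ.mono (hS.measurable T hTs.le).aestronglyMeasurable ?_⟩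
  filter_upwards [hS.ae_nonneg_le hc hT hTs hp] with ω hω
  rw [Real.norm_of_nonneg hω.1, Real.norm_of_nonneg (hω.1.trans hω.2)]
  exact hω.2

lemma IsStableHalfRandomBridge.integral_fst (hS : IsStableHalfRandomBridge c Ts p S P)
    (hc : 0 < c) (hT : 0 < T) (hTs : T < Ts) (hp : Measurable p)
    (hS2 : Integrable (fun ω => S Ts ω ^ 2) P) :
    ∫ ω, S T ω ∂P = T / Ts * ∫ ω, S Ts ω ∂P := by
  obtain ⟨hZ, hX⟩ := hS.memLp hc hT hTs hp hS2
  have hae := hS.ae_nonneg_le hc hT hTs hp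
  have h := hS.lintegral_fst_mul hc hT hTs hp (φ := fun _ => 1) measurable_const
  simp only [mul_one] at h
  rw [← lintegral_const_mul' _ _ ENNReal.ofReal_ne_top] at h
  simp_rw [← ENNReal.ofReal_mul (div_nonneg T.coe_nonneg Ts.coe_nonneg)] at h
  rw [(integrable_and_integral_eq_of_lintegral_eq (hX.integrable one_le_two)
    (hae.mono fun ω hω => hω.1) (hZ.1.const_mul _) (hae.mono fun ω hω =>
      mul_nonneg (div_nonneg T.coe_nonneg Ts.coe_nonneg) (hω.1.trans hω.2)) h).2,
    integral_const_mul]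

lemma IsStableHalfRandomBridge.integral_fst_mul_terminal
    (hS : IsStableHalfRandomBridge c Ts p S P)
    (hc : 0 < c) (hT : 0 < T) (hTs : T < Ts) (hp : Measurable p)
    (hS2 : Integrable (fun ω => S Ts ω ^ 2) P) :
    ∫ ω, S T ω * S Ts ω ∂P = T / Ts * ∫ ω, S Ts ω ^ 2 ∂P := by
  obtain ⟨hZ, hX⟩ := hS.memLp hc hT hTs hp hS2
  have hae := hS.ae_nonneg_le hc hT hTs hp
  have h := hS.lintegral_fst_mul hc hT hTs hp ENNReal.measurable_ofReal
  rw [← lintegral_const_mul' _ _ ENNReal.ofReal_ne_top] at h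
  have hl : ∫⁻ ω, ENNReal.ofReal (S T ω) * ENNReal.ofReal (S Ts ω) ∂P
      = ∫⁻ ω, ENNReal.ofReal (S T ω * S Ts ω) ∂P := lintegral_congr_ae <| by
    filter_upwards [hae] with ω hω using (ENNReal.ofReal_mul hω.1).symm
  have hr : ∫⁻ ω, ENNReal.ofReal (T / Ts) * (ENNReal.ofReal (S Ts ω) * ENNReal.ofReal (S Ts ω)) ∂P
      = ∫⁻ ω, ENNReal.ofReal (T / Ts * S Ts ω ^ 2) ∂P := lintegral_congr_ae <| by
    filter_upwards [hae] with ω hω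
    rw [← ENNReal.ofReal_mul (hω.1.trans hω.2), ← ENNReal.ofReal_mul (by positivity), sq]
  rw [hl, hr] at h
  rw [← integral_const_mul]
  exact (integrable_and_integral_eq_of_lintegral_eq (hX.integrable_mul hZ)
    (hae.mono fun ω hω => mul_nonneg hω.1 (hω.1.trans hω.2)) (hS2.1.const_mul _)
    (.of_forall fun ω => by simp only [Pi.zero_apply]; positivity) h).2

lemma IsStableHalfRandomBridge.integral_fst_mul_snd (hS : IsStableHalfRandomBridge c Ts p S P)
    (hc : 0 < c) (hT : 0 < T) (hTs : T < Ts) (hp : Measurable p) (hp0 : ∀ z, 0 ≤ p z)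
    (hS2 : Integrable (fun ω => S Ts ω ^ 2) P) :
    IntegrableOn (crossIntegrand c Ts p) (Ioi 0) ∧
      ∫ ω, S T ω * (S Ts ω - S T ω) ∂P = T / Ts * (Ts - T) * crossConst c Ts p := by
  obtain ⟨hZ, hX⟩ := hS.memLp hc hT hTs hp hS2
  have hae := hS.ae_nonneg_le hc hT hTs hp
  have hT' : (0 : ℝ) < T := NNReal.coe_pos.2 hT
  have hTs' : (0 : ℝ) < Ts := hT'.trans (NNReal.coe_lt_coe.2 hTs)
  have hr : (0 : ℝ) < Ts - T := sub_pos.2 (NNReal.coe_lt_coe.2 hTs)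
  have hK : 0 < c * T * (Ts - T) * √(2 * Real.pi) / Ts := by positivity
  have h := hS.lintegral_fst_mul_snd hc hT hTs hp
  have hl : ∫⁻ ω, ENNReal.ofReal (S T ω) * ENNReal.ofReal (S Ts ω - S T ω) ∂P
      = ∫⁻ ω, ENNReal.ofReal (S T ω * (S Ts ω - S T ω)) ∂P := lintegral_congr_ae <| by
    filter_upwards [hae] with ω hω using (ENNReal.ofReal_mul hω.1).symm
  rw [hl] at h
  obtain ⟨h1, h2⟩ := integrable_and_integral_eq_of_lintegral_eq
    (hX.integrable_mul (hZ.sub hX))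
    (hae.mono fun ω hω => mul_nonneg hω.1 (sub_nonneg.2 hω.2))
    ((measurable_crossIntegrand c Ts hp).const_mul _).aestronglyMeasurable
    ((ae_restrict_iff' measurableSet_Ioi).2 (.of_forall fun z hz =>
      mul_nonneg hK.le (crossIntegrand_nonneg c Ts hp0 hz))) h
  refine ⟨(integrable_const_mul_iff (IsUnit.mk0 _ hK.ne') _).1 h1, h2.trans ?_⟩
  rw [integral_const_mul, crossConst]
  ring

end Bridge

/-! ### The paid-claims processes and their correlation. -/

lemma timeRatio_mul_add {T Ts : ℝ≥0} (hT : 0 < T) (hTs : T < Ts) :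
    timeRatio T Ts * T + T = Ts := by
  -- Subtraction in `ℝ≥0` truncates; this bound makes `timeRatio` the true difference.
  have h1 : 1 ≤ Ts / T := (one_le_div hT).2 hTs.le
  rw [timeRatio, ← add_one_mul, tsub_add_cancel_of_le h1, div_mul_cancel₀ _ hT.ne']

lemma lossScale_ne_zero {c c₂ : ℝ} (hc : 0 < c) (hc₂ : 0 < c₂) {T Ts : ℝ≥0} (hT : 0 < T)
    (hTs : T < Ts) : lossScale c c₂ T Ts ≠ 0 := by
  have h : 0 < timeRatio T Ts := tsub_pos_of_lt ((one_lt_div hT).2 hTs)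
  have : (0 : ℝ) < timeRatio T Ts := NNReal.coe_pos.2 h
  unfold lossScale
  positivity

theorem mainTheorem8 {Ω : Type*} [MeasurableSpace Ω] (P : Measure Ω) [IsProbabilityMeasure P]
    (c c₂ : ℝ) (hc : 0 < c) (hc₂ : 0 < c₂) (T Ts : ℝ≥0) (hT : 0 < T) (hTs : T < Ts)
    (p : ℝ → ℝ) (hp : Measurable p) (hp0 : ∀ z, 0 ≤ p z)
    (S : ℝ≥0 → Ω → ℝ) (hS : IsStableHalfRandomBridge c Ts p S P)
    (hS2 : Integrable (fun ω => S Ts ω ^ 2) P)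
    (k C m₁ m₂ : ℝ) (hk : k = lossScale c c₂ T Ts) (hC : C = crossConst c Ts p)
    (hm₁ : m₁ = ∫ ω, S Ts ω ∂P) (hm₂ : m₂ = ∫ ω, S Ts ω ^ 2 ∂P)
    (X₁ X₂ : Ω → ℝ) (hX₁ : X₁ = paidClaims₁ S T) (hX₂ : X₂ = paidClaims₂ c c₂ T Ts S T) :
    -- all the integrals below converge
    IntegrableOn (crossIntegrand c Ts p) (Ioi 0) ∧
    Integrable (S Ts) P ∧ Integrable X₁ P ∧ Integrable X₂ P ∧
    Integrable (fun ω => X₁ ω ^ 2) P ∧ Integrable (fun ω => X₂ ω ^ 2) P ∧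
    Integrable (fun ω => X₁ ω * X₂ ω) P ∧
    -- means
    (∫ ω, X₁ ω ∂P) = (T : ℝ) / Ts * m₁ ∧
    (∫ ω, X₂ ω ∂P) = k ^ 2 * (1 - (T : ℝ) / Ts) * m₁ ∧
    -- second moments
    (∫ ω, X₁ ω ^ 2 ∂P) = (T : ℝ) / Ts * m₂ - (T : ℝ) / Ts * ((Ts : ℝ) - T) * C ∧
    (∫ ω, X₂ ω ^ 2 ∂P)
      = k ^ 4 * (1 - (T : ℝ) / Ts) * m₂ - k ^ 4 * (1 - (T : ℝ) / Ts) * T * C ∧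
    -- cross moment
    (∫ ω, X₁ ω * X₂ ω ∂P) = k ^ 2 * ((T : ℝ) / Ts) * ((Ts : ℝ) - T) * C ∧
    -- the correlation is well defined, and its value
    0 < (∫ ω, X₁ ω ^ 2 ∂P) - (∫ ω, X₁ ω ∂P) ^ 2 ∧
    0 < (∫ ω, X₂ ω ^ 2 ∂P) - (∫ ω, X₂ ω ∂P) ^ 2 ∧
    correlation X₁ X₂ P =
      (k ^ 2 * ((T : ℝ) / Ts) * ((Ts : ℝ) - T) * C
          - ((T : ℝ) / Ts * m₁) * (k ^ 2 * (1 - (T : ℝ) / Ts) * m₁)) /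
        Real.sqrt
          (((T : ℝ) / Ts * m₂ - (T : ℝ) / Ts * ((Ts : ℝ) - T) * C
              - ((T : ℝ) / Ts * m₁) ^ 2) *
            (k ^ 4 * (1 - (T : ℝ) / Ts) * m₂ - k ^ 4 * (1 - (T : ℝ) / Ts) * T * C
              - (k ^ 2 * (1 - (T : ℝ) / Ts) * m₁) ^ 2)) := by
  obtain ⟨hZ, hX⟩ := hS.memLp hc hT hTs hp hS2
  have hk0 : k ^ 2 ≠ 0 := pow_ne_zero _ (hk ▸ lossScale_ne_zero hc hc₂ hT hTs)
  have hX₁' : X₁ = S T := hX₁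
  have hX₂' : X₂ = fun ω => k ^ 2 * (S Ts ω - S T ω) := by
    rw [hX₂, hk]
    ext ω
    rw [paidClaims₂, timeRatio_mul_add hT hTs, mul_sub]
  have hY : MemLp (fun ω => S Ts ω - S T ω) 2 P := hZ.sub hX
  have hL₁ : MemLp X₁ 2 P := hX₁' ▸ hX
  have hL₂ : MemLp X₂ 2 P := hX₂' ▸ hY.const_mul _
  obtain ⟨hCint, hXY⟩ := hS.integral_fst_mul_snd hc hT hTs hp hp0 hS2
  rw [← hC] at hXY
  have hXZ := hS.integral_fst_mul_terminal hc hT hTs hp hS2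
  rw [← hm₂] at hXZ
  have hE₁ : ∫ ω, X₁ ω ∂P = (T : ℝ) / Ts * m₁ := by
    rw [hX₁', hm₁, hS.integral_fst hc hT hTs hp hS2]
  have hE₂ : ∫ ω, X₂ ω ∂P = k ^ 2 * (1 - (T : ℝ) / Ts) * m₁ := by
    rw [hX₂', integral_const_mul, integral_sub (hZ.integrable one_le_two)
      (hX.integrable one_le_two), hS.integral_fst hc hT hTs hp hS2, ← hm₁]
    ring
  have hXZi : Integrable (fun ω => S T ω * S Ts ω) P := hX.integrable_mul hZ
  have hXYi : Integrable (fun ω => S T ω * (S Ts ω - S T ω)) P := hX.integrable_mul hY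
  have hZXi : Integrable (fun ω => S Ts ω ^ 2 - S T ω * S Ts ω) P := hS2.sub hXZi
  have hQ₁ : ∫ ω, X₁ ω ^ 2 ∂P = (T : ℝ) / Ts * m₂ - (T : ℝ) / Ts * ((Ts : ℝ) - T) * C := by
    -- With `X = S T` and `Z = S Ts`: `X² = XZ - X(Z - X)`, and below `(Z - X)² = Z² - XZ - X(Z -
    -- X)`.
    rw [hX₁', ← hXY, ← hXZ, ← integral_sub hXZi hXYi]
    exact integral_congr_ae (.of_forall fun ω => by ring)
  have hQ₂ : ∫ ω, X₂ ω ^ 2 ∂P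
      = k ^ 4 * (1 - (T : ℝ) / Ts) * m₂ - k ^ 4 * (1 - (T : ℝ) / Ts) * T * C := by
    have hTs0 : (Ts : ℝ) ≠ 0 := NNReal.coe_ne_zero.2 (hT.trans hTs).ne'
    have h1 : ∫ ω, X₂ ω ^ 2 ∂P = ∫ ω, k ^ 4 * (S Ts ω ^ 2 - S T ω * S Ts ω
        - S T ω * (S Ts ω - S T ω)) ∂P := by
      rw [hX₂']
      exact integral_congr_ae (.of_forall fun ω => by ring)
    rw [h1, integral_const_mul, integral_sub hZXi hXYi, integral_sub hS2 hXZi, hXY, hXZ,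
      ← hm₂]
    field_simp
  have hQ₁₂ : ∫ ω, X₁ ω * X₂ ω ∂P = k ^ 2 * ((T : ℝ) / Ts) * ((Ts : ℝ) - T) * C := by
    have h1 : ∫ ω, X₁ ω * X₂ ω ∂P = ∫ ω, k ^ 2 * (S T ω * (S Ts ω - S T ω)) ∂P := by
      rw [hX₁', hX₂']
      exact integral_congr_ae (.of_forall fun ω => by ring)
    rw [h1, integral_const_mul, hXY]
    ring
  have hne := fun a : ℝ => hS.ae_notMem hc hT hTs hp (measurableSet_singleton a)
    fun t => stableHalfLaw_singleton c t a
  refine ⟨hCint, hZ.integrable one_le_two, hL₁.integrable one_le_two, hL₂.integrable one_le_two,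
    hL₁.integrable_sq, hL₂.integrable_sq, hL₁.integrable_mul hL₂, hE₁, hE₂, hQ₁, hQ₂, hQ₁₂,
    variance_pos_of_forall_ae_ne hL₁ fun a => ?_, variance_pos_of_forall_ae_ne hL₂ fun a => ?_, ?_⟩
  · rw [hX₁']
    exact (hne a).1
  · filter_upwards [(hne (a / k ^ 2)).2] with ω hω h
    rw [hX₂'] at h
    exact hω (eq_div_of_mul_eq hk0 (by linarith))
  · rw [correlation, hE₁, hE₂, hQ₁, hQ₂, hQ₁₂]
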